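/- Let $R$ be a finite associative ring with identity, with $|R| > 1$, and let $k \ge 1$ be an integer. Let $\mathcal{I}_{k+1}(R) = \{x \in R : x^{k+1} = x\}$ be the set of $(k+1)$-potent elements of $R$. Let $p$ be the smallest prime dividing $|R|$, and let $n$ be the number of distinct primes dividing $|R|$. Then $$|\mathcal{I}_{k+1}(R)| \le \left(\frac{k+1}{p}\right)^n |R|^{\frac{2k}{k+1}}.$$ -/

import Mathlib

/-- The set of `(k+1)`-potent elements of a ring `R`: the `x` with `x ^ (k + 1) = x`. -/
def potentElements (R : Type*) [Ring R] (k : ℕ) : Set R :=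
  {x : R | x ^ (k + 1) = x}

/-! Average over integer translates. For fixed `x`, the commutative ring ℤ[x] has a residue field of
characteristic q for each prime q dividing |R|; there X^(k+1) - X has at most k+1 roots, so potency
of x + j confines j to k+1 classes mod q. By CRT at most (k+1)^n of the j below the product of these
primes survive. Double counting pairs (j, x) gives a bound linear in |R|. -/

/-- In a finite ring whose order is divisible by the prime `q`, the `(k+1)`-potent elements among
the integer translates of `x` occupy at most `k + 1` residue classes of integers modulo `q`. -/
theorem exists_residues_of_translates_potent (R : Type*) [Ring R] [Finite R] {k : ℕ} (hk : 1 ≤ k)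
    {q : ℕ} (hq : q.Prime) (hqR : q ∣ Nat.card R) (x : R) :
    ∃ T : Finset (ZMod q), T.card ≤ k + 1 ∧
      ∀ j : ℕ, x + (j : R) ∈ potentElements R k → (j : ZMod q) ∈ T := by
  classical
  have : Fact q.Prime := ⟨hq⟩
  let S := Algebra.adjoin ℤ {x}
  have : IsMulCommutative S := Algebra.isMulCommutative_adjoin ℤ (by simp)
  -- A unit kills no nonzero element, but Cauchy's theorem gives some `y` of additive order `q`.
  have hqS : ¬ IsUnit (q : S) := by
    intro h
    obtain ⟨y, hy⟩ := exists_prime_addOrderOf_dvd_card' (G := R) q hqR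
    have hu : IsUnit (q : R) := by simpa using h.map S.val
    have h0 : (q : R) * y = 0 := by
      rw [← nsmul_eq_mul, ← hy, addOrderOf_nsmul_eq_zero]
    rw [hu.mul_right_eq_zero] at h0
    rw [h0, addOrderOf_zero] at hy
    exact hq.one_lt.ne hy
  obtain ⟨M, hM, hqM⟩ := exists_max_ideal_of_mem_nonunits hqS
  let : Field (S ⧸ M) := Ideal.Quotient.field M
  have hq0 : (q : S ⧸ M) = 0 := by
    rw [← map_natCast (Ideal.Quotient.mk M)]
    exact Ideal.Quotient.eq_zero_iff_mem.2 hqM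
  have : CharP (S ⧸ M) q := ringChar.of_eq (CharP.ringChar_of_prime_eq_zero hq hq0)
  let s : S := ⟨x, Algebra.self_mem_adjoin_singleton ℤ x⟩
  let a : S ⧸ M := Ideal.Quotient.mk M s
  let f : Polynomial (S ⧸ M) := Polynomial.X ^ (k + 1) - Polynomial.X
  have hdeg : f.natDegree = k + 1 := FiniteField.X_pow_card_sub_X_natDegree_eq _ (by omega)
  have hf0 : f ≠ 0 := FiniteField.X_pow_card_sub_X_ne_zero _ (by omega)
  let c : ZMod q → S ⧸ M := fun t => a + ZMod.castHom dvd_rfl (S ⧸ M) t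
  have hc : Function.Injective c :=
    (add_right_injective a).comp (ZMod.castHom dvd_rfl (S ⧸ M)).injective
  refine ⟨f.roots.toFinset.preimage c hc.injOn, ?_, ?_⟩
  · calc _ ≤ f.roots.toFinset.card := by
          rw [← Finset.card_image_of_injective _ hc]
          exact Finset.card_le_card (Finset.image_subset_iff.2 fun t ht => by simpa using ht)
      _ ≤ Multiset.card f.roots := Multiset.toFinset_card_le _
      _ ≤ f.natDegree := Polynomial.card_roots' f
      _ = k + 1 := hdeg
  · intro j hj
    have hS : (s + (j : S)) ^ (k + 1) = s + (j : S) := by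
      apply Subtype.ext
      simpa [potentElements, s] using hj
    have hF := congrArg (Ideal.Quotient.mk M) hS
    simp only [map_pow, map_add, map_natCast] at hF
    simp only [Finset.mem_preimage, Multiset.mem_toFinset, Polynomial.mem_roots hf0,
      Polynomial.IsRoot, f, c, map_natCast, Polynomial.eval_sub, Polynomial.eval_pow,
      Polynomial.eval_X, sub_eq_zero]
    exact hF

/-- With `P` a set of primes dividing the order of a finite ring, at most `(k + 1) ^ |P|` of the
translates `x + j` with `0 ≤ j < ∏ q ∈ P, q` are `(k+1)`-potent. -/
theorem card_translates_potent_le (R : Type*) [Ring R] [Finite R] {k : ℕ} (hk : 1 ≤ k)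
    (P : Finset ℕ) (hP : ∀ q ∈ P, q.Prime ∧ q ∣ Nat.card R) (x : R)
    [DecidablePred fun j : ℕ => x + (j : R) ∈ potentElements R k] :
    ((Finset.range (∏ q ∈ P, q)).filter
      fun j : ℕ => x + (j : R) ∈ potentElements R k).card ≤ (k + 1) ^ P.card := by
  classical
  choose T hT hTj using fun q : P =>
    exists_residues_of_translates_potent R hk (hP q q.2).1 (hP q q.2).2 x
  calc _ ≤ (Fintype.piFinset T).card := by
        -- Residues modulo all `q ∈ P` determine `j` below their product.
        refine Finset.card_le_card_of_injOn (fun j q => (j : ZMod q)) ?_ ?_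
        · intro j hj
          simp only [Finset.coe_filter, Set.mem_ofPred_eq] at hj
          exact Finset.mem_coe.2 (Fintype.mem_piFinset.2 fun q => hTj q j hj.2)
        · intro i hi j hj hij
          simp only [Finset.coe_filter, Set.mem_ofPred_eq, Finset.mem_range] at hi hj
          have hdvd : ((∏ q ∈ P, q : ℕ) : ℤ) ∣ (j : ℤ) - i := by
            push_cast
            refine Finset.prod_dvd_of_coprime ?_ ?_
            · intro q hq r hr hqr
              exact Nat.isCoprime_iff_coprime.2
                ((Nat.coprime_primes (hP q hq).1 (hP r hr).1).2 hqr)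
            · intro q hq
              exact Nat.modEq_iff_dvd.1 ((ZMod.natCast_eq_natCast_iff _ _ _).1
                (congrFun hij ⟨q, hq⟩))
          exact (Nat.modEq_iff_dvd.2 hdvd).eq_of_lt_of_lt hi.1 hj.1
    _ = ∏ q : P, (T q).card := Fintype.card_piFinset T
    _ ≤ ∏ _q : P, (k + 1) := Finset.prod_le_prod' fun q _ => hT q
    _ = (k + 1) ^ P.card := by simp

/-- If `P` is a set of primes dividing the order of a finite ring `R`, the proportion of
`(k+1)`-potent elements in `R` is at most `∏ q ∈ P, (k + 1) / q`. -/
theorem prod_primes_mul_ncard_potentElements_le (R : Type*) [Ring R] [Finite R] {k : ℕ}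
    (hk : 1 ≤ k) (P : Finset ℕ) (hP : ∀ q ∈ P, q.Prime ∧ q ∣ Nat.card R) :
    (∏ q ∈ P, q) * (potentElements R k).ncard ≤ (k + 1) ^ P.card * Nat.card R := by
  classical
  have := Fintype.ofFinite R
  have hcol : ∀ j : ℕ, (Finset.univ.filter fun x : R => x + (j : R) ∈ potentElements R k).card
      = (potentElements R k).ncard := by
    intro j
    rw [Set.ncard_eq_toFinset_card']
    refine Finset.card_bij (fun x _ => x + (j : R)) (by simp) (by simp) ?_
    intro y hy
    exact ⟨y - j, by simpa using hy, by simp⟩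
  have hdc := Finset.sum_card_bipartiteAbove_eq_sum_card_bipartiteBelow
    (s := Finset.range (∏ q ∈ P, q)) (t := (Finset.univ : Finset R))
    (fun (j : ℕ) (x : R) => x + (j : R) ∈ potentElements R k)
  simp only [Finset.bipartiteAbove, Finset.bipartiteBelow, hcol, Finset.sum_const,
    Finset.card_range, smul_eq_mul] at hdc
  rw [hdc]
  calc _ ≤ ∑ _x : R, (k + 1) ^ P.card :=
        Finset.sum_le_sum fun x _ => card_translates_potent_le R hk P hP x
    _ = (k + 1) ^ P.card * Nat.card R := by simp [mul_comm]

theorem mainTheorem6 (R : Type*) [Ring R] [Finite R] (k : ℕ) (hk : 1 ≤ k)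
    (p : ℕ) (hp : IsLeast {q : ℕ | q.Prime ∧ q ∣ Nat.card R} p)
    (n : ℕ) (hn : n = {q : ℕ | q.Prime ∧ q ∣ Nat.card R}.ncard) :
    ((potentElements R k).ncard : ℝ) ≤
      (((k : ℝ) + 1) / (p : ℝ)) ^ n *
        (Nat.card R : ℝ) ^ (2 * (k : ℝ) / ((k : ℝ) + 1)) := by
  have hR : 0 < Nat.card R := Nat.card_pos
  have hset : {q : ℕ | q.Prime ∧ q ∣ Nat.card R} = ((Nat.card R).primeFactors : Set ℕ) := by
    ext q
    simp [hR.ne']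
  have hcard : (Nat.card R).primeFactors.card = n := by rw [hn, hset, Set.ncard_coe_finset]
  have hmain := prod_primes_mul_ncard_potentElements_le R hk (Nat.card R).primeFactors
    fun q hq => ⟨Nat.prime_of_mem_primeFactors hq, Nat.dvd_of_mem_primeFactors hq⟩
  have hpn : p ^ n ≤ ∏ q ∈ (Nat.card R).primeFactors, q := by
    rw [← hcard]
    exact Finset.pow_card_le_prod _ _ _ fun q hq =>
      hp.2 ⟨Nat.prime_of_mem_primeFactors hq, Nat.dvd_of_mem_primeFactors hq⟩
  have hp0 : (0 : ℝ) < p := by exact_mod_cast hp.1.1.pos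
  have hbound : ((p : ℝ) ^ n) * (potentElements R k).ncard ≤ ((k : ℝ) + 1) ^ n * Nat.card R := by
    rw [hcard] at hmain
    exact_mod_cast (Nat.mul_le_mul_right _ hpn).trans hmain
  have hk' : (1 : ℝ) ≤ k := by exact_mod_cast hk
  -- The exponent is at least 1 because `k ≥ 1`, so the linear bound is the stronger one.
  have hexp : (Nat.card R : ℝ) ≤ (Nat.card R : ℝ) ^ (2 * (k : ℝ) / ((k : ℝ) + 1)) := by
    refine Real.self_le_rpow_of_one_le (by exact_mod_cast hR) ?_
    rw [one_le_div (by positivity)]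
    linarith
  calc ((potentElements R k).ncard : ℝ) ≤ (((k : ℝ) + 1) / p) ^ n * Nat.card R := by
        rw [div_pow, div_mul_eq_mul_div, le_div_iff₀ (by positivity), mul_comm]
        exact hbound
    _ ≤ _ := by gcongr
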